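/- Let $A$ be a left Noetherian ring that is either commutative or local (a not necessarily commutative ring is local if it has a unique maximal left ideal). All modules are left modules. For an $A$-module $M$ put $$\operatorname{ext.deg}(M)=\sup\{\,i\ge 0 \mid \operatorname{Ext}_A^i(M,M)\neq 0\,\},$$ and let $$\operatorname{fed}(A)=\sup\{\operatorname{ext.deg}(M)\mid M \text{ a finitely generated } A\text{-module with } \operatorname{ext.deg}(M)<\infty\}.$$ Write $\operatorname{pd}(M)$ for the projective dimension of $M$ and $\operatorname{id}(A)$ for the injective dimension of $A$ as a left $A$-module; suprema are taken in $\{-\infty\}\cup\mathbb{N}\cup\{\infty\}$ with $\sup\emptyset=-\infty$, and the zero module has projective and injective dimension $-\infty$. If $\operatorname{id}(A)<\infty$ and $\operatorname{fed}(A)<\infty$, then $$\operatorname{ext.deg}(M)=\operatorname{pd}(M)$$ for every finitely generated $A$-module $M$ (in particular, one side is $\infty$ if and only if the other is). -/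

import Mathlib

open CategoryTheory

universe u

/-- The self-extension degree of a left `A`-module `M`: the supremum of all `i` such that
`Ext^i_A(M, M) ≠ 0`, computed in `{-∞} ∪ ℕ ∪ {+∞}` (so that it is `-∞ = ⊥` exactly when `M = 0`,
in accordance with `projectiveDimension`). -/
noncomputable def selfExtDegree {A : Type u} [Ring A] (M : ModuleCat.{u} A) : WithBot ℕ∞ :=
  sSup {n : WithBot ℕ∞ | ∃ i : ℕ, Nontrivial (Abelian.Ext.{u} M M i) ∧ n = (i : WithBot ℕ∞)}

/-- The finitistic extension degree of a ring `A`: the supremum of the self-extension degrees of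
those finitely generated left `A`-modules whose self-extension degree is finite. -/
noncomputable def finitisticExtDegree (A : Type u) [Ring A] : WithBot ℕ∞ :=
  sSup {n : WithBot ℕ∞ | ∃ M : ModuleCat.{u} A,
    Module.Finite A M ∧ selfExtDegree M < ⊤ ∧ n = selfExtDegree M}

/-!
The equality `ext.deg M = pd M` splits according to whether `pd M` is finite.

**Finite projective dimension.** Let `pd M = n`. Then `Ext^i(M, M) = 0` for `i > n`, and one has to
see that `Ext^n(M, M) ≠ 0` (`nontrivial_ext_self`). As `Ext^(n+1)(M, -) = 0`, the functor
`Ext^n(M, -)` is right exact, so if `Ext^n(M, M) = 0` then `Ext^n(M, M/N) = 0` for every submodule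
`N`; this is contradicted for a suitable maximal submodule `N`.

* If `A` is local, all simple modules are isomorphic, and covers by free modules of minimal rank
  show that `Ext^n(M, S) = 0` with `S` simple forces `pd M < n`
  (`hasProjectiveDimensionLT_of_ext_simple`).
* If `A` is commutative, `E = Ext^n(M, A)` is nonzero and finitely generated. Let `m` be a maximal
  ideal containing the annihilator of `E`, hence that of `M`. By Nakayama `mM ≠ M`, so `M` has a
  quotient isomorphic to `A/m`. Vanishing of `Ext^n(M, A/m)` means that
  `Ext^n(M, m) → E` is surjective; covering `m` by a free module gives `E = mE`, and Nakayama
  contradicts the choice of `m` (`nontrivial_ext_self_of_commRing`).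

**Finite self-extension degree implies finite projective dimension.** Since `id A` is finite,
the property that `Ext^i(X, Y) = 0` for large `i` passes to syzygies in both variables. Replacing
`M` by its `d`-th syzygy, where `d` bounds `id A`, one may assume `Ext^i(M, A) = 0` for all `i > 0`.
If `M` is not projective, then `Ext^1(M, ΩM) ≠ 0`, and dimension shifting in the second variable
gives `Ext^k(M, Ω^k M) ≠ 0` for all `k > 0`. The modules `M ⊕ Ω^k M` have finite self-extension
degree at least `k`, which contradicts the finiteness of `fed A`
(`projective_of_finitisticExtDegree_lt_top`).
-/

open Abelian Filter

/-! ### The self-extension degree -/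

section Degree

variable {A : Type u} [Ring A]

lemma exists_nat_gt_of_lt_top {x : WithBot ℕ∞} (hx : x < ⊤) : ∃ n : ℕ, x < n := by
  induction x with
  | bot => exact ⟨0, WithBot.bot_lt_coe _⟩
  | coe x =>
    induction x with
    | top => exact absurd hx (lt_irrefl _)
    | coe m => exact ⟨m + 1, by exact_mod_cast Nat.lt_succ_self m⟩

lemma natCast_le_selfExtDegree {X : ModuleCat.{u} A} {i : ℕ} (h : Nontrivial (Ext.{u} X X i)) :
    (i : WithBot ℕ∞) ≤ selfExtDegree X :=
  le_sSup ⟨i, h, rfl⟩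

lemma selfExtDegree_le {X : ModuleCat.{u} A} {n : ℕ}
    (h : ∀ i, n < i → Subsingleton (Ext.{u} X X i)) : selfExtDegree X ≤ n := by
  refine sSup_le ?_
  rintro _ ⟨i, hi, rfl⟩
  by_contra hlt
  exact not_nontrivial_iff_subsingleton.2 (h i (by exact_mod_cast not_le.1 hlt)) hi

lemma selfExtDegree_lt_top_iff {X : ModuleCat.{u} A} :
    selfExtDegree X < ⊤ ↔ ∀ᶠ i in atTop, Subsingleton (Ext.{u} X X i) := by
  constructor
  · intro h
    obtain ⟨n, hn⟩ := exists_nat_gt_of_lt_top h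
    filter_upwards [eventually_ge_atTop n] with i hi
    by_contra hns
    have h1 := natCast_le_selfExtDegree (not_subsingleton_iff_nontrivial.1 hns)
    exact absurd (h1.trans_lt hn) (not_lt.2 (by exact_mod_cast hi))
  · intro h
    obtain ⟨n, hn⟩ := eventually_atTop.1 h
    refine (selfExtDegree_le (n := n) fun i hi ↦ hn i hi.le).trans_lt ?_
    exact WithBot.coe_lt_coe.2 (ENat.natCast_lt_top n)

lemma selfExtDegree_eq_projectiveDimension_of_isZero {X : ModuleCat.{u} A}
    (hX : Limits.IsZero X) : selfExtDegree X = projectiveDimension X := by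
  have := hX.hasProjectiveDimensionLT_zero
  rw [(projectiveDimension_eq_bot_iff X).2 hX, eq_bot_iff]
  refine sSup_le ?_
  rintro _ ⟨i, hi, rfl⟩
  exact absurd (HasProjectiveDimensionLT.subsingleton X 0 i (Nat.zero_le _) X)
    (not_subsingleton_iff_nontrivial.2 hi)

end Degree

/-! ### Finite free covers -/

section Covers

variable {A : Type u} [Ring A]

lemma exists_finite_free_cover [IsNoetherianRing A] (X : ModuleCat.{u} A) [Module.Finite A X] :
    ∃ (r : ℕ) (K : ModuleCat.{u} A) (i : K ⟶ ModuleCat.of A (Fin r → A))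
      (p : ModuleCat.of A (Fin r → A) ⟶ X) (w : i ≫ p = 0),
      (ShortComplex.mk i p w).ShortExact ∧ Module.Finite A K := by
  obtain ⟨r, f, hf⟩ := Module.Finite.exists_fin' A X
  exact ⟨r, _, _, _, _, LinearMap.shortExact_shortComplexKer hf,
    inferInstanceAs (Module.Finite A (LinearMap.ker f))⟩

lemma projective_of_fin_pow (r : ℕ) : Projective (ModuleCat.of A (Fin r → A)) :=
  inferInstance

/-- The decomposition of an extension class with values in `A^r` into its `r` coordinates. -/
lemma ext_comp_sum_single (X : ModuleCat.{u} A) {n r : ℕ}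
    (e : Ext.{u} X (ModuleCat.of A (Fin r → A)) n) :
    e = ∑ i, (e.comp
      (Ext.mk₀ (ModuleCat.ofHom (LinearMap.proj (R := A) (φ := fun _ : Fin r ↦ A) i)))
      (add_zero n)).comp (Ext.mk₀ (ModuleCat.ofHom (LinearMap.single A (fun _ : Fin r ↦ A) i)))
        (add_zero n) := by
  have h : 𝟙 (ModuleCat.of A (Fin r → A)) = ∑ i,
      ModuleCat.ofHom (LinearMap.proj (R := A) (φ := fun _ : Fin r ↦ A) i) ≫
        ModuleCat.ofHom (LinearMap.single A (fun _ : Fin r ↦ A) i) := by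
    ext : 1
    simp only [ModuleCat.hom_id, ModuleCat.hom_sum, ModuleCat.hom_comp, ModuleCat.hom_ofHom]
    exact LinearMap.ext fun v ↦ by
      simpa [LinearMap.sum_apply] using (Finset.univ_sum_single v).symm
  conv_lhs => rw [← Ext.comp_mk₀_id e, h, Ext.mk₀_sum, Ext.comp_sum]
  refine Finset.sum_congr rfl fun i _ ↦ ?_
  rw [Ext.comp_assoc_of_third_deg_zero, Ext.mk₀_comp_mk₀]

lemma ext_fin_pow_subsingleton {X : ModuleCat.{u} A} {n : ℕ} (r : ℕ)
    (h : Subsingleton (Ext.{u} X (ModuleCat.of A A) n)) :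
    Subsingleton (Ext.{u} X (ModuleCat.of A (Fin r → A)) n) := by
  refine subsingleton_of_forall_eq 0 fun e ↦ ?_
  rw [ext_comp_sum_single X e]
  refine Finset.sum_eq_zero fun i _ ↦ ?_
  rw [Subsingleton.elim (Ext.comp e _ _) 0, Ext.zero_comp]

end Covers

/-! ### Dimension shifting -/

section Shifting

variable {A : Type u} [Ring A] {S : ShortComplex (ModuleCat.{u} A)} (hS : S.ShortExact)
include hS

/-- Dimension shifting in the first variable along `0 → X₁ → P → X₃ → 0` with `P` projective:
`Ext^(n+2)(X₃, Y) = 0` implies `Ext^(n+1)(X₁, Y) = 0`. -/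
lemma ext_syzygy_subsingleton_of_succ [Projective S.X₂] {Y : ModuleCat.{u} A} {n : ℕ}
    (h : Subsingleton (Ext.{u} S.X₃ Y (n + 2))) : Subsingleton (Ext.{u} S.X₁ Y (n + 1)) := by
  refine subsingleton_of_forall_eq 0 fun e ↦ ?_
  obtain ⟨x, rfl⟩ := Ext.contravariant_sequence_exact₁ hS Y e (n₁ := n + 2) (by lia)
    (Subsingleton.elim _ _)
  rw [x.eq_zero_of_projective, Ext.comp_zero]

/-- Dimension shifting in the second variable: the connecting map
`Ext^n(X, X₃) → Ext^(n+1)(X, X₁)` is injective when `Ext^n(X, X₂) = 0`. -/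
lemma ext_subsingleton_of_ext_succ_syzygy {X : ModuleCat.{u} A} {n : ℕ}
    (h₂ : Subsingleton (Ext.{u} X S.X₂ n)) (h₁ : Subsingleton (Ext.{u} X S.X₁ (n + 1))) :
    Subsingleton (Ext.{u} X S.X₃ n) := by
  refine subsingleton_of_forall_eq 0 fun e ↦ ?_
  obtain ⟨x, rfl⟩ := Ext.covariant_sequence_exact₃ X hS e (n₁ := n + 1) rfl (Subsingleton.elim _ _)
  rw [Subsingleton.elim x 0, Ext.zero_comp]

/-- Dimension shifting in the second variable: the connecting map
`Ext^n(X, X₃) → Ext^(n+1)(X, X₁)` is surjective when `Ext^(n+1)(X, X₂) = 0`. -/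
lemma ext_succ_syzygy_subsingleton {X : ModuleCat.{u} A} {n : ℕ}
    (h₂ : Subsingleton (Ext.{u} X S.X₂ (n + 1))) (h₃ : Subsingleton (Ext.{u} X S.X₃ n)) :
    Subsingleton (Ext.{u} X S.X₁ (n + 1)) := by
  refine subsingleton_of_forall_eq 0 fun e ↦ ?_
  obtain ⟨x, rfl⟩ := Ext.covariant_sequence_exact₁ X hS e (Subsingleton.elim _ _) rfl
  rw [Subsingleton.elim x 0, Ext.zero_comp]

/-- The class of `0 → ΩX → P → X → 0` lives in `Ext^1(X, ΩX)`; if it vanishes, the sequence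
splits. -/
lemma projective_of_ext_one_syzygy [Projective S.X₂]
    (h : Subsingleton (Ext.{u} S.X₃ S.X₁ 1)) : Projective S.X₃ := by
  obtain ⟨x, hx⟩ := Ext.covariant_sequence_exact₃ S.X₃ hS (Ext.mk₀ (𝟙 S.X₃)) (n₁ := 1) rfl
    (Subsingleton.elim _ _)
  obtain ⟨s, rfl⟩ := (Ext.mk₀_bijective _ _).2 x
  rw [Ext.mk₀_comp_mk₀] at hx
  exact (Retract.mk s S.g ((Ext.mk₀_bijective _ _).1 hx)).projective

/-- If `X` has projective dimension at most `n`, then `Ext^n(X, -)` is right exact. -/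
lemma ext_top_postcomp_surjective {X : ModuleCat.{u} A} {n : ℕ}
    (hX : HasProjectiveDimensionLE X n) (e : Ext.{u} X S.X₃ n) :
    ∃ x : Ext.{u} X S.X₂ n, x.comp (Ext.mk₀ S.g) (add_zero n) = e :=
  Ext.covariant_sequence_exact₃ X hS e rfl
    (Ext.eq_zero_of_hasProjectiveDimensionLT _ (n + 1) le_rfl)

end Shifting

/-! ### Finiteness of the projective dimension -/

section Finiteness

variable {A : Type u} [Ring A]

/-- `Ext^i(X, Y)` vanishes for all sufficiently large `i`. -/
def EventuallyExtZero (X Y : ModuleCat.{u} A) : Prop :=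
  ∀ᶠ i in atTop, Subsingleton (Ext.{u} X Y i)

lemma EventuallyExtZero.syzygy_left {S : ShortComplex (ModuleCat.{u} A)} (hS : S.ShortExact)
    [Projective S.X₂] {Y : ModuleCat.{u} A} (h : EventuallyExtZero S.X₃ Y) :
    EventuallyExtZero S.X₁ Y := by
  obtain ⟨n, hn⟩ := eventually_atTop.1 h
  refine eventually_atTop.2 ⟨n + 1, fun i hi ↦ ?_⟩
  obtain ⟨j, rfl⟩ : ∃ j, i = j + 1 := ⟨i - 1, by lia⟩
  exact ext_syzygy_subsingleton_of_succ hS (hn _ (by lia))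

lemma EventuallyExtZero.syzygy_right {S : ShortComplex (ModuleCat.{u} A)} (hS : S.ShortExact)
    {X : ModuleCat.{u} A} (h₂ : EventuallyExtZero X S.X₂) (h : EventuallyExtZero X S.X₃) :
    EventuallyExtZero X S.X₁ := by
  obtain ⟨n, hn⟩ := eventually_atTop.1 (h.and h₂)
  refine eventually_atTop.2 ⟨n + 1, fun i hi ↦ ?_⟩
  obtain ⟨j, rfl⟩ : ∃ j, i = j + 1 := ⟨i - 1, by lia⟩
  exact ext_succ_syzygy_subsingleton hS (hn _ (by lia)).2 (hn _ (by lia)).1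

lemma EventuallyExtZero.biprod {X Y : ModuleCat.{u} A} (hXX : EventuallyExtZero X X)
    (hXY : EventuallyExtZero X Y) (hYX : EventuallyExtZero Y X) (hYY : EventuallyExtZero Y Y) :
    EventuallyExtZero (X ⊞ Y) (X ⊞ Y) := by
  filter_upwards [hXX, hXY, hYX, hYY] with i h1 h2 h3 h4
  have := (Ext.addEquivBiprod (X := X) (Y₁ := X) (Y₂ := Y) (n := i)).toEquiv.subsingleton
  have := (Ext.addEquivBiprod (X := Y) (Y₁ := X) (Y₂ := Y) (n := i)).toEquiv.subsingleton
  exact (Ext.biprodAddEquiv (X₁ := X) (X₂ := Y) (Y := X ⊞ Y) (n := i)).toEquiv.subsingleton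

lemma nontrivial_ext_biprod {X Y : ModuleCat.{u} A} {i : ℕ} (h : Nontrivial (Ext.{u} X Y i)) :
    Nontrivial (Ext.{u} (X ⊞ Y) (X ⊞ Y) i) := by
  have := (Ext.addEquivBiprod (X := X) (Y₁ := X) (Y₂ := Y) (n := i)).toEquiv.nontrivial
  exact (Ext.biprodAddEquiv (X₁ := X) (X₂ := Y) (Y := X ⊞ Y) (n := i)).toEquiv.nontrivial

lemma finite_biprod (X Y : ModuleCat.{u} A) [Module.Finite A X] [Module.Finite A Y] :
    Module.Finite A (X ⊞ Y : ModuleCat.{u} A) :=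
  Module.Finite.equiv (ModuleCat.biprodIsoProd X Y).toLinearEquiv.symm

lemma eventuallyExtZero_fin_pow (hid : injectiveDimension (ModuleCat.of A A) < ⊤)
    (X : ModuleCat.{u} A) (r : ℕ) : EventuallyExtZero X (ModuleCat.of A (Fin r → A)) := by
  obtain ⟨d, hd⟩ := exists_nat_gt_of_lt_top hid
  have := injectiveDimension_lt_iff.1 hd
  filter_upwards [eventually_ge_atTop d] with i hi
  exact ext_fin_pow_subsingleton r (HasInjectiveDimensionLT.subsingleton _ d i hi X)

/-- If `X` is not projective and `Ext^i(X, A) = 0` for all `i > 0`, then `Y = Ω^(k+1) X` satisfies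
`Ext^(k+1)(X, Y) ≠ 0`, while all `Ext` groups between `X` and `Y` vanish in large degrees. -/
lemma exists_kth_syzygy [IsNoetherianRing A] (hid : injectiveDimension (ModuleCat.of A A) < ⊤)
    {X : ModuleCat.{u} A} [Module.Finite A X] (hXX : EventuallyExtZero X X)
    (hXA : ∀ i, 0 < i → Subsingleton (Ext.{u} X (ModuleCat.of A A) i)) (hX : ¬ Projective X)
    (k : ℕ) :
    ∃ Y : ModuleCat.{u} A, Module.Finite A Y ∧ EventuallyExtZero X Y ∧ EventuallyExtZero Y X ∧
      EventuallyExtZero Y Y ∧ Nontrivial (Ext.{u} X Y (k + 1)) := by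
  induction k with
  | zero =>
    obtain ⟨r, K, i, p, w, hS, hK⟩ := exists_finite_free_cover X
    have hXK : EventuallyExtZero X K :=
      .syzygy_right hS (eventuallyExtZero_fin_pow hid X r) hXX
    have : Projective (ShortComplex.mk i p w).X₂ := projective_of_fin_pow r
    refine ⟨K, hK, hXK, .syzygy_left hS hXX, .syzygy_left hS hXK, ?_⟩
    rw [← not_subsingleton_iff_nontrivial]
    exact fun h ↦ hX (projective_of_ext_one_syzygy hS h)
  | succ k ih =>
    obtain ⟨Y, hY, hXY, hYX, hYY, hne⟩ := ih
    obtain ⟨r, K, i, p, w, hS, hK⟩ := exists_finite_free_cover Y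
    have : Projective (ShortComplex.mk i p w).X₂ := projective_of_fin_pow r
    refine ⟨K, hK, .syzygy_right hS (eventuallyExtZero_fin_pow hid X r) hXY,
      .syzygy_left hS hYX,
      .syzygy_left hS (.syzygy_right hS (eventuallyExtZero_fin_pow hid Y r) hYY), ?_⟩
    rw [← not_subsingleton_iff_nontrivial] at hne ⊢
    exact fun h ↦ hne (ext_subsingleton_of_ext_succ_syzygy hS
      (ext_fin_pow_subsingleton r (hXA _ k.succ_pos)) h)

/-- The modules `X ⊕ Ω^(k+1) X` have finite self-extension degree, at least `k + 1` if `X` is not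
projective, so that a bound on these degrees makes `X` projective. -/
lemma projective_of_finitisticExtDegree_lt_top [IsNoetherianRing A]
    (hid : injectiveDimension (ModuleCat.of A A) < ⊤)
    (hfed : finitisticExtDegree A < ⊤) {X : ModuleCat.{u} A} [Module.Finite A X]
    (hXX : EventuallyExtZero X X)
    (hXA : ∀ i, 0 < i → Subsingleton (Ext.{u} X (ModuleCat.of A A) i)) : Projective X := by
  by_contra hX
  obtain ⟨k, hk⟩ := exists_nat_gt_of_lt_top hfed
  obtain ⟨Y, _, hXY, hYX, hYY, hne⟩ := exists_kth_syzygy hid hXX hXA hX k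
  have h1 : selfExtDegree (X ⊞ Y) ≤ finitisticExtDegree A :=
    le_sSup ⟨X ⊞ Y, finite_biprod X Y,
      selfExtDegree_lt_top_iff.2 (hXX.biprod hXY hYX hYY), rfl⟩
  have h2 := ((natCast_le_selfExtDegree (nontrivial_ext_biprod hne)).trans h1).trans_lt hk
  exact absurd h2 (not_lt.2 (by exact_mod_cast k.le_succ))

/-- Passing to a syzygy lowers `d` by one, which reduces the claim to the case `d = 0`. -/
lemma hasProjectiveDimensionLE_of_finitisticExtDegree_lt_top [IsNoetherianRing A]
    (hid : injectiveDimension (ModuleCat.of A A) < ⊤)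
    (hfed : finitisticExtDegree A < ⊤) (d : ℕ) (X : ModuleCat.{u} A) [Module.Finite A X]
    (hXX : EventuallyExtZero X X)
    (hXA : ∀ i, d < i → Subsingleton (Ext.{u} X (ModuleCat.of A A) i)) :
    HasProjectiveDimensionLE X d := by
  induction d generalizing X with
  | zero =>
    exact (projective_iff_hasProjectiveDimensionLE_zero X).1
      (projective_of_finitisticExtDegree_lt_top hid hfed hXX hXA)
  | succ d ih =>
    obtain ⟨r, K, i, p, w, hS, hK⟩ := exists_finite_free_cover X
    have hP : Projective (ShortComplex.mk i p w).X₂ := projective_of_fin_pow r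
    refine (hS.hasProjectiveDimensionLT_X₃_iff d hP).2 (ih K (.syzygy_left hS
      (.syzygy_right hS (eventuallyExtZero_fin_pow hid X r) hXX)) fun i hi ↦ ?_)
    obtain ⟨j, rfl⟩ : ∃ j, i = j + 1 := ⟨i - 1, by lia⟩
    exact ext_syzygy_subsingleton_of_succ hS (hXA _ (by lia))

lemma projectiveDimension_lt_top_of_selfExtDegree_lt_top [IsNoetherianRing A]
    (hid : injectiveDimension (ModuleCat.of A A) < ⊤)
    (hfed : finitisticExtDegree A < ⊤) (X : ModuleCat.{u} A) [Module.Finite A X]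
    (hX : selfExtDegree X < ⊤) : projectiveDimension X < ⊤ := by
  obtain ⟨d, hd⟩ := exists_nat_gt_of_lt_top hid
  have := injectiveDimension_lt_iff.1 hd
  refine lt_top_iff_ne_top.2 ((projectiveDimension_ne_top_iff X).2 ⟨d, ?_⟩)
  exact hasProjectiveDimensionLE_of_finitisticExtDegree_lt_top hid hfed d X
    (selfExtDegree_lt_top_iff.1 hX)
    fun i hi ↦ HasInjectiveDimensionLT.subsingleton _ d i hi.le X

end Finiteness

/-! ### `Ext` in the degree of the projective dimension -/

section TopDegree

variable {A : Type u} [Ring A]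

lemma hasProjectiveDimensionLT_zero_of_ext_self {X : ModuleCat.{u} A}
    (h : Subsingleton (Ext.{u} X X 0)) : HasProjectiveDimensionLT X 0 := by
  have h0 : 𝟙 X = 0 := (Ext.mk₀_bijective X X).1 (Subsingleton.elim _ _)
  exact ((Limits.IsZero.iff_id_eq_zero X).2 h0).hasProjectiveDimensionLT_zero

/-- Over a Noetherian ring, the projective dimension of a finitely generated module is detected by
`Ext` in a single degree and with finitely generated coefficients, because syzygies are finitely
generated. -/
lemma hasProjectiveDimensionLT_of_forall_ext [IsNoetherianRing A] (n : ℕ) (X : ModuleCat.{u} A)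
    [Module.Finite A X]
    (h : ∀ Y : ModuleCat.{u} A, Module.Finite A Y → Subsingleton (Ext.{u} X Y n)) :
    HasProjectiveDimensionLT X n := by
  induction n generalizing X with
  | zero => exact hasProjectiveDimensionLT_zero_of_ext_self (h X ‹_›)
  | succ n ih =>
    obtain ⟨r, K, i, p, w, hS, hK⟩ := exists_finite_free_cover X
    have hP : Projective (ShortComplex.mk i p w).X₂ := projective_of_fin_pow r
    cases n with
    | zero =>
      exact projective_iff_hasProjectiveDimensionLT_one.1
        (projective_of_ext_one_syzygy hS (h K hK))
    | succ n =>
      exact (hS.hasProjectiveDimensionLT_X₃_iff n hP).2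
        (ih K fun Y hY ↦ ext_syzygy_subsingleton_of_succ hS (h Y hY))

/-- By right exactness of `Ext^n(X, -)`, vanishing on `A` would give vanishing on all finitely
generated modules. -/
lemma nontrivial_ext_ring [IsNoetherianRing A] {X : ModuleCat.{u} A} [Module.Finite A X] {n : ℕ}
    (hle : HasProjectiveDimensionLE X n) (hlt : ¬ HasProjectiveDimensionLT X n) :
    Nontrivial (Ext.{u} X (ModuleCat.of A A) n) := by
  rw [← not_subsingleton_iff_nontrivial]
  refine fun h ↦ hlt (hasProjectiveDimensionLT_of_forall_ext n X fun Y _ ↦ ?_)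
  obtain ⟨r, K, i, p, w, hS, hK⟩ := exists_finite_free_cover Y
  have := ext_fin_pow_subsingleton r h
  refine subsingleton_of_forall_eq 0 fun e ↦ ?_
  obtain ⟨x, rfl⟩ := ext_top_postcomp_surjective hS hle e
  rw [Subsingleton.elim x 0, Ext.zero_comp]

lemma ext_quotient_subsingleton {X : ModuleCat.{u} A} {n : ℕ}
    (hle : HasProjectiveDimensionLE X n) (h : Subsingleton (Ext.{u} X X n)) (N : Submodule A X) :
    Subsingleton (Ext.{u} X (ModuleCat.of A (X ⧸ N)) n) := by
  refine subsingleton_of_forall_eq 0 fun e ↦ ?_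
  obtain ⟨x, rfl⟩ := ext_top_postcomp_surjective
    (LinearMap.shortExact_shortComplexKer N.mkQ_surjective) hle e
  rw [Subsingleton.elim x 0, Ext.zero_comp]

end TopDegree

/-! ### Commutative rings -/

section Commutative

variable {R : Type u} [CommRing R]

/-- A linear map `f : R^r → R` with values in `I` is a combination of the coordinates with
coefficients in `I`, so it maps `Ext^n(X, R^r)` into `I • Ext^n(X, R)`. -/
lemma comp_mk₀_mem_smul_top {X : ModuleCat.{u} R} {n r : ℕ}
    (e : Ext.{u} X (ModuleCat.of R (Fin r → R)) n) (f : (Fin r → R) →ₗ[R] R) {I : Ideal R}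
    (hf : ∀ v, f v ∈ I) :
    e.comp (Ext.mk₀ (ModuleCat.ofHom f)) (add_zero n) ∈
      I • (⊤ : Submodule R (Ext.{u} X (ModuleCat.of R R) n)) := by
  rw [ext_comp_sum_single X e, Ext.sum_comp]
  refine Submodule.sum_mem _ fun i _ ↦ ?_
  have h : ModuleCat.ofHom (LinearMap.single R (fun _ : Fin r ↦ R) i) ≫ ModuleCat.ofHom f =
      f (Pi.single i 1) • 𝟙 (ModuleCat.of R R) := by
    ext
    simp
  rw [Ext.comp_assoc_of_third_deg_zero, Ext.mk₀_comp_mk₀, h, ← Ext.smul_eq_comp_mk₀]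
  exact Submodule.smul_mem_smul (hf _) Submodule.mem_top

lemma smul_ext_eq_zero {X Y : ModuleCat.{u} R} {a : R} (ha : ∀ x : X, a • x = 0) {n : ℕ}
    (e : Ext.{u} X Y n) : a • e = 0 := by
  have h : a • 𝟙 X = 0 := by
    ext x
    exact ha x
  rw [← Ext.mk₀_id_comp e, ← Ext.smul_comp, ← Ext.mk₀_smul, h, Ext.mk₀_zero, Ext.zero_comp]

lemma nontrivial_ext_self_of_commRing [IsNoetherianRing R] (X : ModuleCat.{u} R)
    [Module.Finite R X] {n : ℕ}
    (hle : HasProjectiveDimensionLE X n) (hlt : ¬ HasProjectiveDimensionLT X n) :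
    Nontrivial (Ext.{u} X X n) := by
  rw [← not_subsingleton_iff_nontrivial]
  intro h
  have hE := nontrivial_ext_ring hle hlt
  set E := Ext.{u} X (ModuleCat.of R R) n
  obtain ⟨m, hm, hEm⟩ := Ideal.exists_le_maximal (Module.annihilator R E)
    fun h ↦ not_subsingleton E (Module.annihilator_eq_top_iff.1 h)
  -- The annihilator of `X` lies in that of `E`, hence in `m`, so Nakayama applies to `X` and `m`.
  have hmX : m • (⊤ : Submodule R X) ≠ ⊤ := by
    intro htop
    obtain ⟨a, ha, haX⟩ := Submodule.exists_sub_one_mem_and_smul_eq_zero_of_fg_of_le_smul m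
      (⊤ : Submodule R X) Module.Finite.fg_top htop.ge
    have ham : a ∈ m := hEm (Module.mem_annihilator.2
      fun e ↦ smul_ext_eq_zero (fun x ↦ haX x Submodule.mem_top) e)
    exact hm.ne_top ((Ideal.eq_top_iff_one _).2 (by simpa using m.sub_mem ham ha))
  obtain ⟨N, hN, hmN⟩ := (eq_top_or_exists_le_coatom _).resolve_left hmX
  have hsimple : IsSimpleModule R (X ⧸ N) := isSimpleModule_iff_isCoatom.2 hN
  obtain ⟨q, hq⟩ := @exists_ne _ (IsSimpleModule.nontrivial R (X ⧸ N)) 0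
  -- `g : R → X/N` realises the simple quotient `X/N` as `R/m`.
  set g := LinearMap.toSpanSingleton R (X ⧸ N) q
  have hg : Function.Surjective g := IsSimpleModule.toSpanSingleton_surjective R hq
  have hker : LinearMap.ker g ≤ m := by
    have hmg : m ≤ LinearMap.ker g := by
      intro a ha
      obtain ⟨x, rfl⟩ := N.mkQ_surjective q
      change a • N.mkQ x = 0
      rw [← map_smul, Submodule.mkQ_apply, Submodule.Quotient.mk_eq_zero]
      exact hmN (Submodule.smul_mem_smul ha Submodule.mem_top)
    refine (hm.eq_of_le (fun h ↦ hq ?_) hmg).ge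
    have h1 : (1 : R) ∈ LinearMap.ker g := h ▸ Submodule.mem_top
    simpa [g] using h1
  have hXN := ext_quotient_subsingleton hle h N
  obtain ⟨r, f, hf⟩ := Module.Finite.exists_fin' R (LinearMap.ker g)
  -- Since `Ext^n(X, R/m) = 0`, every class in `E` comes from `Ext^n(X, m)`, hence from a free cover
  -- of `m`.
  have hsmul : (⊤ : Submodule R E) ≤ m • ⊤ := by
    rintro (e : Ext.{u} X (ModuleCat.of R R) n) -
    obtain ⟨e₁, rfl⟩ := Ext.covariant_sequence_exact₂ X (LinearMap.shortExact_shortComplexKer hg) e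
      (@Subsingleton.elim _ hXN _ _)
    obtain ⟨e₂, rfl⟩ := ext_top_postcomp_surjective (LinearMap.shortExact_shortComplexKer hf) hle e₁
    rw [Ext.comp_assoc_of_third_deg_zero, Ext.mk₀_comp_mk₀]
    exact comp_mk₀_mem_smul_top e₂ ((LinearMap.ker g).subtype ∘ₗ f) fun v ↦ hker (f v).2
  obtain ⟨a, ha, haE⟩ := Submodule.exists_sub_one_mem_and_smul_eq_zero_of_fg_of_le_smul m
    (⊤ : Submodule R E) (ModuleCat.finite_ext R X (ModuleCat.of R R) n).fg_top hsmul
  have ham : a ∈ m := hEm (Module.mem_annihilator.2 fun e ↦ haE e Submodule.mem_top)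
  exact hm.ne_top ((Ideal.eq_top_iff_one _).2 (by simpa using m.sub_mem ham ha))

end Commutative

/-! ### Local rings -/

section Local

variable {A : Type u} [Ring A]

/-- A surjection `A^r → X` with `r` minimal has no kernel element with a left invertible coordinate,
since such an element would make one of the `r` generators redundant. Over a local ring this says
that the kernel is contained in the radical of `A^r`. -/
lemma exists_minimal_cover (X : Type u) [AddCommGroup X] [Module A X] [Module.Finite A X] :
    ∃ (r : ℕ) (f : (Fin r → A) →ₗ[A] X), Function.Surjective f ∧
      ∀ v ∈ LinearMap.ker f, ∀ i, ∀ a : A, a * v i ≠ 1 := by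
  classical
  have hex : ∃ r : ℕ, ∃ f : (Fin r → A) →ₗ[A] X, Function.Surjective f :=
    Module.Finite.exists_fin' A X
  obtain ⟨f, hf⟩ := Nat.find_spec hex
  have hmin := fun r' ↦ Nat.find_min hex (m := r')
  generalize Nat.find hex = r at f hf hmin
  refine ⟨r, f, hf, fun v hv i a ha ↦ ?_⟩
  obtain _ | r := r
  · exact i.elim0
  refine hmin r r.lt_succ_self
    ⟨Fintype.linearCombination A fun j ↦ f (Pi.single (i.succAbove j) 1), fun x ↦ ?_⟩
  obtain ⟨u, rfl⟩ := hf x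
  -- Subtracting a multiple of `v` removes the `i`-th coordinate without changing the image.
  set w := u - (u i * a) • v with hw
  have hwi : w i = 0 := by simp [hw, mul_assoc, ha]
  have hfw : f w = f u := by rw [hw, map_sub, map_smul, LinearMap.mem_ker.1 hv, smul_zero, sub_zero]
  refine ⟨fun j ↦ w (i.succAbove j), ?_⟩
  have hsum : w = ∑ j, w j • Pi.single j (1 : A) := pi_eq_sum_univ' w
  rw [← hfw, Fintype.linearCombination_apply]
  conv_rhs => rw [hsum, map_sum, Fin.sum_univ_succAbove _ i]
  simp [hwi]

lemma exists_isSimpleModule_quotient (X : Type*) [AddCommGroup X] [Module A X]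
    [Module.Finite A X] [Nontrivial X] : ∃ N : Submodule A X, IsSimpleModule A (X ⧸ N) := by
  obtain ⟨N, hN, -⟩ := (eq_top_or_exists_le_coatom (⊥ : Submodule A X)).resolve_left bot_ne_top
  exact ⟨N, isSimpleModule_iff_isCoatom.2 hN⟩

/-- Elements of a local ring without a left inverse annihilate simple modules. -/
lemma smul_simple_eq_zero [IsLocalRing A] {S : Type*} [AddCommGroup S] [Module A S]
    [IsSimpleModule A S] {a : A} (ha : ∀ b : A, b * a ≠ 1) (s : S) : a • s = 0 := by
  by_contra hs
  obtain ⟨b, hb⟩ := IsSimpleModule.toSpanSingleton_surjective A hs s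
  replace hb : b • a • s = s := hb
  rcases IsLocalRing.isUnit_or_isUnit_of_add_one (sub_add_cancel 1 (b * a)) with h | h
  · refine hs ?_
    have hz : (1 - b * a) • s = 0 := by rw [sub_smul, one_smul, mul_smul, hb, sub_self]
    rw [(h.smul_eq_zero).1 hz, smul_zero]
  · obtain ⟨c, hc⟩ := h.exists_left_inv
    exact ha (c * b) (by rw [mul_assoc, hc])

lemma nonempty_linearEquiv_of_isSimpleModule [IsLocalRing A] (S T : Type*) [AddCommGroup S]
    [Module A S] [AddCommGroup T] [Module A T] [IsSimpleModule A S] [IsSimpleModule A T] :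
    Nonempty (S ≃ₗ[A] T) := by
  obtain ⟨I, hI, ⟨e⟩⟩ := isSimpleModule_iff_quot_maximal.1 ‹IsSimpleModule A S›
  obtain ⟨J, hJ, ⟨e'⟩⟩ := isSimpleModule_iff_quot_maximal.1 ‹IsSimpleModule A T›
  have hIJ : I = J := by
    by_contra hne
    have htop : I ⊔ J = ⊤ := Ideal.IsMaximal.coprime_of_ne hI hJ hne
    obtain ⟨a, ha, b, hb, hab⟩ := Submodule.mem_sup.1 (htop ▸ Submodule.mem_top : (1 : A) ∈ I ⊔ J)
    rcases IsLocalRing.isUnit_or_isUnit_of_add_one hab with h | h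
    · exact hI.ne_top (I.eq_top_of_isUnit_mem ha h)
    · exact hJ.ne_top (J.eq_top_of_isUnit_mem hb h)
  subst hIJ
  exact ⟨e.trans e'.symm⟩

/-- Over a local ring the projective dimension is detected by `Ext` into the simple module `S`. For
a minimal cover `A^r → X`, restriction `Hom(A^r, S) → Hom(K, S)` to the kernel `K` is zero, so that
`Ext^n(K, S)` embeds into `Ext^(n+1)(X, S)` for all `n`, including `n = 0`. -/
lemma hasProjectiveDimensionLT_of_ext_simple [IsLocalRing A] [IsNoetherianRing A] (S : Type u)
    [AddCommGroup S] [Module A S] [IsSimpleModule A S] (n : ℕ) (X : ModuleCat.{u} A)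
    [Module.Finite A X] (h : Subsingleton (Ext.{u} X (ModuleCat.of A S) n)) :
    HasProjectiveDimensionLT X n := by
  induction n generalizing X with
  | zero =>
    by_contra hX
    have hX' : ¬ Subsingleton X := fun h ↦
      hX (ModuleCat.isZero_of_subsingleton X).hasProjectiveDimensionLT_zero
    rw [not_subsingleton_iff_nontrivial] at hX'
    obtain ⟨N, hN⟩ := exists_isSimpleModule_quotient (A := A) X
    obtain ⟨e⟩ := nonempty_linearEquiv_of_isSimpleModule (A := A) (X ⧸ N) S
    have h0 : ModuleCat.ofHom (e.toLinearMap ∘ₗ N.mkQ) = (0 : X ⟶ ModuleCat.of A S) :=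
      (Ext.mk₀_bijective _ _).1 (Subsingleton.elim _ _)
    obtain ⟨s, hs⟩ := @exists_ne _ (IsSimpleModule.nontrivial A S) 0
    obtain ⟨x, rfl⟩ := (e.surjective.comp N.mkQ_surjective) s
    exact hs (congr($(h0).hom x))
  | succ n ih =>
    obtain ⟨r, f, hf, hmin⟩ := exists_minimal_cover (A := A) X
    have hS := LinearMap.shortExact_shortComplexKer hf
    have hP : Projective f.shortComplexKer.X₂ := projective_of_fin_pow r
    have hK : HasProjectiveDimensionLT f.shortComplexKer.X₁ n := by
      refine ih (ModuleCat.of A (LinearMap.ker f)) (subsingleton_of_forall_eq 0 fun e ↦ ?_)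
      obtain ⟨x, rfl⟩ := Ext.contravariant_sequence_exact₁ hS (ModuleCat.of A S) e (add_comm 1 n)
        (Subsingleton.elim _ _)
      cases n with
      | zero =>
        obtain ⟨φ, rfl⟩ := (Ext.mk₀_bijective _ _).2 x
        rw [Ext.mk₀_comp_mk₀, Ext.mk₀_eq_zero_iff]
        ext v
        change φ.hom v.1 = 0
        rw [pi_eq_sum_univ' v.1, map_sum]
        exact Finset.sum_eq_zero fun i _ ↦ by
          rw [map_smul]
          exact smul_simple_eq_zero (hmin v.1 v.2 i) _
      | succ n => rw [x.eq_zero_of_projective, Ext.comp_zero]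
    exact hS.hasProjectiveDimensionLT_X₃ n hK inferInstance

lemma nontrivial_ext_self_of_isLocalRing [IsLocalRing A] [IsNoetherianRing A]
    (X : ModuleCat.{u} A) [Module.Finite A X] {n : ℕ}
    (hle : HasProjectiveDimensionLE X n) (hlt : ¬ HasProjectiveDimensionLT X n) :
    Nontrivial (Ext.{u} X X n) := by
  rw [← not_subsingleton_iff_nontrivial]
  intro h
  have hX' : ¬ Subsingleton X := fun _ ↦
    have := (ModuleCat.isZero_of_subsingleton X).hasProjectiveDimensionLT_zero
    hlt (hasProjectiveDimensionLT_of_ge X 0 n n.zero_le)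
  rw [not_subsingleton_iff_nontrivial] at hX'
  obtain ⟨N, hN⟩ := exists_isSimpleModule_quotient (A := A) X
  exact hlt (hasProjectiveDimensionLT_of_ext_simple (X ⧸ N) n X (ext_quotient_subsingleton hle h N))

end Local

/-! ### Self-extension degree and projective dimension -/

lemma nontrivial_ext_self {A : Type u} [Ring A] [IsNoetherianRing A]
    (hA : (∀ a b : A, a * b = b * a) ∨ IsLocalRing A) (X : ModuleCat.{u} A) [Module.Finite A X]
    {n : ℕ} (hle : HasProjectiveDimensionLE X n) (hlt : ¬ HasProjectiveDimensionLT X n) :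
    Nontrivial (Ext.{u} X X n) := by
  rcases hA with hcomm | _
  -- The commutative ring structure has the given ring structure underlying it definitionally.
  · let _ : CommRing A := { ‹Ring A› with mul_comm := hcomm }
    exact nontrivial_ext_self_of_commRing X hle hlt
  · exact nontrivial_ext_self_of_isLocalRing X hle hlt

lemma selfExtDegree_eq_projectiveDimension_of_lt_top {A : Type u} [Ring A] [IsNoetherianRing A]
    (hA : (∀ a b : A, a * b = b * a) ∨ IsLocalRing A) (X : ModuleCat.{u} A) [Module.Finite A X]
    (hX : projectiveDimension X < ⊤) : selfExtDegree X = projectiveDimension X := by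
  classical
  obtain ⟨m, hm⟩ := exists_nat_gt_of_lt_top hX
  have hex : ∃ m : ℕ, HasProjectiveDimensionLT X m := ⟨m, projectiveDimension_lt_iff.1 hm⟩
  have hspec := Nat.find_spec hex
  have hmin := fun k ↦ Nat.find_min hex (m := k)
  generalize Nat.find hex = n at hspec hmin
  obtain _ | n := n
  · exact selfExtDegree_eq_projectiveDimension_of_isZero
      ((hasProjectiveDimensionLT_zero_iff_isZero X).1 hspec)
  · have hlt := hmin n n.lt_succ_self
    refine le_antisymm ?_ ?_
    · exact (selfExtDegree_le fun i hi ↦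
        HasProjectiveDimensionLT.subsingleton X (n + 1) i hi X).trans
          ((projectiveDimension_ge_iff X n).2 hlt)
    · exact ((projectiveDimension_le_iff X n).2 hspec).trans
        (natCast_le_selfExtDegree (nontrivial_ext_self hA X hspec hlt))

theorem mainTheorem8 (A : Type u) [Ring A] [IsNoetherianRing A]
    (hA : (∀ a b : A, a * b = b * a) ∨ IsLocalRing A)
    (hid : injectiveDimension (ModuleCat.of A A) < ⊤)
    (hfed : finitisticExtDegree A < ⊤)
    (M : Type u) [AddCommGroup M] [Module A M] [Module.Finite A M] :
    selfExtDegree (ModuleCat.of A M) = projectiveDimension (ModuleCat.of A M) := by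
  by_cases hpd : projectiveDimension (ModuleCat.of A M) < ⊤
  · exact selfExtDegree_eq_projectiveDimension_of_lt_top hA _ hpd
  · have hdeg : ¬ selfExtDegree (ModuleCat.of A M) < ⊤ := fun h ↦
      hpd (projectiveDimension_lt_top_of_selfExtDegree_lt_top hid hfed _ h)
    rw [not_lt_top_iff.1 hpd, not_lt_top_iff.1 hdeg]
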